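/- Call a linear subspace $V\subseteq\mathbb{R}^\ell$ $k$-bounded if $\dim V\le k$. Let $\mathcal V=(V_1,\dots,V_n)$ be a list of linear subspaces of $\mathbb{R}^\ell$, let $\alpha$ be a positive integer and $\delta>0$ a real number. A list $\mathcal S=(S_1,\dots,S_w)$ of sets (repetitions allowed) is an $(\alpha,\delta)$-system of $\mathcal V$ if (1) every $S_j$ is a subset of $[n]=\{1,\dots,n\}$ of size $3$ or $2$; (2) if $S_j=\{i_1,i_2,i_3\}$ has three elements, then $V_{i_1}\subseteq V_{i_2}+V_{i_3}$, $V_{i_2}\subseteq V_{i_1}+V_{i_3}$ and $V_{i_3}\subseteq V_{i_1}+V_{i_2}$, and if $S_j=\{i_1,i_2\}$ has two elements, then $V_{i_1}=V_{i_2}$; (3) every $i\in[n]$ is contained in at least $\delta n$ of the sets $S_1,\dots,S_w$; (4) every pair $\{i_1,i_2\}$ with $i_1\ne i_2$ in $[n]$ is contained in at most $\alpha$ of the sets $S_1,\dots,S_w$. Theorem. Let $\mathcal V=(V_1,\dots,V_n)$ be a list of $k$-bounded subspaces of $\mathbb{R}^\ell$ that has an $(\alpha,\delta)$-system, and let $d=\dim(V_1+\cdots+V_n)$.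 Then for every $\beta\in(0,1)$ at least one of the following holds: (i) $d\le \dfrac{400\,\alpha k^3}{\beta\delta}$; (ii) there are $q\ge \dfrac{\delta n}{20\alpha}$ distinct indices $i_1,\dots,i_q\in[n]$ and nonzero vectors $z_1\in V_{i_1},\dots,z_q\in V_{i_q}$ such that $\dim\operatorname{span}(z_1,\dots,z_q)\le\beta d$. -/

import Mathlib

/-- A subspace `V` of `ℝ^ℓ` is `k`-bounded if its dimension is at most `k`. -/
def IsKBounded {ℓ : ℕ} (k : ℕ) (V : Submodule ℝ (EuclideanSpace ℝ (Fin ℓ))) : Prop :=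
  Module.finrank ℝ V ≤ k

/-- `S = (S_1, …, S_w)` (a list of subsets of the index set, repetitions allowed) is an
`(α, δ)`-system of the list `V = (V_1, …, V_n)` of subspaces of `ℝ^ℓ`.
The parameters are meant to satisfy `0 < α` and `0 < δ`. -/
structure IsSystem {ℓ n w : ℕ} (α : ℕ) (δ : ℝ)
    (V : Fin n → Submodule ℝ (EuclideanSpace ℝ (Fin ℓ)))
    (S : Fin w → Finset (Fin n)) : Prop where
  /-- Every set has size three or two. -/
  card_eq : ∀ j, (S j).card = 3 ∨ (S j).card = 2
  /-- In a set of three elements, each space is contained in the sum of the other two. -/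
  triple : ∀ j i₁ i₂ i₃, i₁ ≠ i₂ → i₁ ≠ i₃ → i₂ ≠ i₃ → S j = {i₁, i₂, i₃} →
    V i₁ ≤ V i₂ ⊔ V i₃ ∧ V i₂ ≤ V i₁ ⊔ V i₃ ∧ V i₃ ≤ V i₁ ⊔ V i₂
  /-- In a set of two elements, the two spaces coincide. -/
  pair : ∀ j i₁ i₂, i₁ ≠ i₂ → S j = {i₁, i₂} → V i₁ = V i₂
  /-- Every index lies in at least `δ n` of the sets. -/
  le_count : ∀ i, δ * (n : ℝ) ≤ ((Finset.univ.filter fun j : Fin w => i ∈ S j).card : ℝ)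
  /-- Every pair of distinct indices lies in at most `α` of the sets. -/
  pair_count_le : ∀ i₁ i₂, i₁ ≠ i₂ →
    (Finset.univ.filter fun j : Fin w => i₁ ∈ S j ∧ i₂ ∈ S j).card ≤ α

open Module

/-! Suppose (ii) fails, so no subspace of dimension at most `β d` meets `c = δ n / (20 α)` of the
spaces nontrivially. A greedy choice (`exists_disjoint_supIndep`) then packs all but fewer than `c`
of the nonzero spaces into `N` disjoint independent families, each with more than `β d / k` members;
hence `N β d ≤ k n`.

Each family extends to a direct sum decomposition of the ambient space. One linear automorphism puts
all `N` decompositions in balanced position: the squared projections of a unit vector onto all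
summands add up to at most `2 (N + 1)` (`exists_equiv_sum_norm_starProjection_sq_le`, by maximizing
a ratio of determinants over contractions). So a space of dimension at most `k` is near, in angle,
to only `O(N k)` of the packed spaces.

The dependencies survive the automorphism, and every dependent triple or pair with a nonzero space
contains a near pair (`exists_isNear_of_le_sup`). As a pair lies in at most `α` sets and a packed
index in about `δ n` sets avoiding the unpacked nonzero spaces, double counting gives `δ n = O(α k
N)`. Combined with `N β d ≤ k n`, this bounds `d`. -/

theorem Matrix.det_blockDiagonal'_eq_prod {κ : Type*} [Fintype κ] [DecidableEq κ] {m : κ → Type*}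
    [∀ i, Fintype (m i)] [∀ i, DecidableEq (m i)] (A : ∀ i, Matrix (m i) (m i) ℝ) :
    (Matrix.blockDiagonal' A).det = ∏ i, (A i).det := by
  classical
  let e := Fintype.equivFin κ
  let _ : LinearOrder κ := LinearOrder.lift' e e.injective
  rw [(Matrix.blockTriangular_blockDiagonal' A).det_fintype]
  refine Finset.prod_congr rfl fun i _ => ?_
  let f : m i ≃ {x : Σ i, m i // x.1 = i} :=
    { toFun := fun x => ⟨⟨i, x⟩, rfl⟩
      invFun := fun x => x.2 ▸ x.1.2
      left_inv := fun x => rfl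
      right_inv := by rintro ⟨⟨j, x⟩, rfl⟩; rfl }
  rw [← Matrix.det_submatrix_equiv_self f]
  congr 1
  ext a b
  simp [Matrix.toSquareBlock_def, f]

/-! ### Volume factors: Hadamard, Fischer, and a rank-one contraction -/

section

variable {E : Type*} [NormedAddCommGroup E] [InnerProductSpace ℝ E]

/-- A special case of Hadamard's inequality. -/
theorem det_gram_le_one {ι : Type*} [Fintype ι] [DecidableEq ι] (e : ι → E)
    (he : ∀ i, ‖e i‖ = 1) : (Matrix.gram ℝ e).det ≤ 1 := by
  have hp := Matrix.posSemidef_gram ℝ e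
  have htr := hp.isHermitian.trace_eq_sum_eigenvalues
  rw [hp.isHermitian.det_eq_prod_eigenvalues]
  have h1 : (Matrix.gram ℝ e).trace = Fintype.card ι := by
    simp [Matrix.trace, Matrix.gram_apply, he]
  simp only [RCLike.ofReal_real_eq_id, id] at htr ⊢
  -- AM-GM in exponential form: `λ ≤ exp (λ - 1)`, and the eigenvalues sum to their number.
  calc ∏ i, hp.isHermitian.eigenvalues i
      ≤ ∏ i, Real.exp (hp.isHermitian.eigenvalues i - 1) :=
        Finset.prod_le_prod (fun i _ => hp.eigenvalues_nonneg i) fun i _ => by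
          have := Real.add_one_le_exp (hp.isHermitian.eigenvalues i - 1)
          linarith
    _ = 1 := by
        rw [← Real.exp_sum, Finset.sum_sub_distrib, ← htr, h1]
        simp

variable [FiniteDimensional ℝ E]

/-- A form of Fischer's inequality: up to a constant depending on the decomposition only, the
determinant is bounded by the product of the volume factors on the summands. -/
theorem exists_abs_det_le_mul_prod_normDet {κ : Type*} [Fintype κ] [DecidableEq κ]
    {U : κ → Submodule ℝ E} (hU : DirectSum.IsInternal U) :
    ∃ C : ℝ, 0 < C ∧ ∀ M : E →ₗ[ℝ] E, Function.Injective M →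
      |LinearMap.det M| ≤ C * ∏ i, (M.domRestrict (U i)).normDet := by
  classical
  let b : ∀ i, OrthonormalBasis (Fin (finrank ℝ (U i))) ℝ (U i) := fun i => stdOrthonormalBasis ℝ _
  let a := hU.collectedBasis fun i => (b i).toBasis
  have hcard : finrank ℝ E = Fintype.card (Σ i, Fin (finrank ℝ (U i))) :=
    finrank_eq_card_basis a
  let o : OrthonormalBasis (Σ i, Fin (finrank ℝ (U i))) ℝ E :=
    (stdOrthonormalBasis ℝ E).reindex (Fintype.equivOfCardEq (by simp [hcard]))
  have hc : 0 < |(o.toBasis.toMatrix a).det| := by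
    rw [abs_pos, ← Basis.det_apply]
    exact (o.toBasis.isUnit_det a).ne_zero
  refine ⟨|(o.toBasis.toMatrix a).det|⁻¹, inv_pos.2 hc, fun M hM => ?_⟩
  have hinj : ∀ i, Function.Injective (M.domRestrict (U i)) := fun i x y h =>
    Subtype.ext (hM h)
  have hR : ∀ i, Nonempty (OrthonormalBasis (Fin (finrank ℝ (U i))) ℝ
      (M.domRestrict (U i)).range) := fun i =>
    ((M.domRestrict (U i)).normDet_ne_zero_tfae.out 4 3).mp (hinj i)
  let e : ∀ i, OrthonormalBasis (Fin (finrank ℝ (U i))) ℝ (M.domRestrict (U i)).range :=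
    fun i => (hR i).some
  let A : ∀ i, Matrix (Fin (finrank ℝ (U i))) (Fin (finrank ℝ (U i))) ℝ := fun i =>
    (M.domRestrict (U i)).rangeRestrict.toMatrix (b i).toBasis (e i).toBasis
  let w : (Σ i, Fin (finrank ℝ (U i))) → E := fun q => (e q.1 q.2 : E)
  let W : Matrix (Σ i, Fin (finrank ℝ (U i))) (Σ i, Fin (finrank ℝ (U i))) ℝ :=
    Matrix.of fun p q => o.repr (w q) p
  have hA : ∀ i, |(A i).det| = (M.domRestrict (U i)).normDet := fun i =>
    (LinearMap.normDet_eq_norm_det_toMatrix_rangeRestrict _ (b i) (e i)).symm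
  have hMb : ∀ i j, M (b i j) = ∑ l, A i l j • (e i l : E) := by
    intro i j
    have h := (e i).toBasis.sum_repr ((M.domRestrict (U i)).rangeRestrict (b i j))
    have h2 := congrArg Subtype.val h
    simp only [AddSubmonoidClass.coe_finsetSum, SetLike.val_smul] at h2
    refine Eq.trans (show M (b i j) = _ from rfl) (h2.symm.trans ?_)
    refine Finset.sum_congr rfl fun l _ => ?_
    simp [A, LinearMap.toMatrix_apply]
  -- Both sides have as columns the images under `M` of the basis `a` adapted to the decomposition.
  -- The blocks carry the volume factors, and `W` has unit columns, so Hadamard applies to it.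
  have hmul : LinearMap.toMatrix o.toBasis o.toBasis M * o.toBasis.toMatrix a
      = W * Matrix.blockDiagonal' A := by
    rw [linearMap_toMatrix_mul_basis_toMatrix]
    ext p ⟨i, j⟩
    rw [LinearMap.toMatrix_apply, Matrix.mul_apply, Fintype.sum_sigma,
      Finset.sum_eq_single i (fun k _ hk => Finset.sum_eq_zero fun l _ => by
        rw [Matrix.blockDiagonal'_apply_ne _ _ _ hk, mul_zero]) (by simp)]
    simp only [Matrix.blockDiagonal'_apply_eq]
    have ha : a ⟨i, j⟩ = b i j := by simp [a]
    rw [ha, hMb]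
    simp [W, w, mul_comm]
  have hdet := congrArg (fun X => |Matrix.det X|) hmul
  simp only [Matrix.det_mul, abs_mul, LinearMap.det_toMatrix,
    Matrix.det_blockDiagonal'_eq_prod, Finset.abs_prod, hA] at hdet
  have hW : |W.det| ≤ 1 := by
    have h1 := det_gram_le_one w fun q => (e q.1).norm_eq_one q.2
    rw [Matrix.gram_eq_conjTranspose_mul o w] at h1
    change (W.conjTranspose * W).det ≤ 1 at h1
    rw [Matrix.det_mul, Matrix.det_conjTranspose, star_trivial, ← sq, sq_le_one_iff_abs_le_one]
      at h1
    exact h1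
  rw [inv_mul_eq_div, le_div_iff₀ hc, hdet]
  exact mul_le_of_le_one_left (Finset.prod_nonneg fun i _ => LinearMap.normDet_nonneg _) hW

/-- The contraction `x ↦ x - ⟪v, x⟫ v / 2`. -/
noncomputable def halfContract (v : E) : E →L[ℝ] E :=
  ContinuousLinearMap.id ℝ E - (1 / 2 : ℝ) • (innerSL ℝ v).smulRight v

omit [FiniteDimensional ℝ E] in
theorem halfContract_apply (v x : E) : halfContract v x = x - ((1 / 2 : ℝ) * inner ℝ v x) • v := by
  simp [halfContract, smul_smul]

omit [FiniteDimensional ℝ E] in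
theorem inner_halfContract {v : E} (hv : ‖v‖ = 1) (x y : E) :
    inner ℝ (halfContract v x) (halfContract v y)
      = inner ℝ x y - 3 / 4 * (inner ℝ v x * inner ℝ v y) := by
  simp only [halfContract_apply, inner_sub_left, inner_sub_right, real_inner_smul_left,
    real_inner_smul_right, real_inner_self_eq_norm_sq, hv, real_inner_comm v x]
  ring

omit [FiniteDimensional ℝ E] in
theorem norm_halfContract_le {v : E} (hv : ‖v‖ = 1) : ‖halfContract v‖ ≤ 1 := by
  refine ContinuousLinearMap.opNorm_le_bound _ zero_le_one fun x => ?_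
  rw [one_mul, ← sq_le_sq₀ (norm_nonneg _) (norm_nonneg _), ← real_inner_self_eq_norm_sq,
    ← real_inner_self_eq_norm_sq, inner_halfContract hv]
  linarith [mul_self_nonneg (inner ℝ v x)]

-- The Gram matrix of the images is the identity minus a matrix of rank one, so its determinant
-- reduces to a scalar.
omit [FiniteDimensional ℝ E] in
theorem normDet_halfContract_comp_sq {F : Type*} [NormedAddCommGroup F] [InnerProductSpace ℝ F]
    [FiniteDimensional ℝ F] {v : E} (hv : ‖v‖ = 1) (f : F →ₗᵢ[ℝ] E) {ι : Type*} [Fintype ι]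
    (b : OrthonormalBasis ι ℝ F) :
    ((halfContract v).toLinearMap ∘ₗ f.toLinearMap).normDet ^ 2
      = 1 - 3 / 4 * ∑ i, inner ℝ v (f (b i)) ^ 2 := by
  classical
  have h := LinearMap.normDet_sq_eq_det_gram ((halfContract v).toLinearMap ∘ₗ f.toLinearMap) b
  have hg : Matrix.gram ℝ (((halfContract v).toLinearMap ∘ₗ f.toLinearMap) <| b ·)
      = 1 - Matrix.replicateCol Unit (fun i => 3 / 4 * inner ℝ v (f (b i)))
        * Matrix.replicateRow Unit (fun i => inner ℝ v (f (b i))) := by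
    ext i j
    simp [Matrix.gram_apply, inner_halfContract hv, Matrix.mul_apply, Matrix.one_apply,
      orthonormal_iff_ite.1 b.orthonormal, mul_assoc]
  rw [hg, Matrix.det_one_sub_mul_comm] at h
  simp only [RCLike.ofReal_real_eq_id, id] at h
  rw [h]
  simp [Matrix.mul_apply, Finset.mul_sum, sq]
  refine Finset.sum_congr rfl fun i _ => by ring

theorem sum_inner_sq_eq_norm_starProjection_sq (R : Submodule ℝ E) (v : E) {ι : Type*} [Fintype ι]
    (b : OrthonormalBasis ι ℝ R) :
    ∑ i, inner ℝ v (b i : E) ^ 2 = ‖R.starProjection v‖ ^ 2 := by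
  have h := b.sum_sq_inner_left (R.orthogonalProjectionOnto v)
  rw [Submodule.starProjection_apply, ← Submodule.coe_norm, ← h]
  simp

theorem normDet_halfContract_domRestrict_sq {v : E} (hv : ‖v‖ = 1) (R : Submodule ℝ E) :
    ((halfContract v).toLinearMap.domRestrict R).normDet ^ 2
      = 1 - 3 / 4 * ‖R.starProjection v‖ ^ 2 := by
  rw [← sum_inner_sq_eq_norm_starProjection_sq R v (stdOrthonormalBasis ℝ R)]
  exact normDet_halfContract_comp_sq hv R.subtypeₗᵢ (stdOrthonormalBasis ℝ R)

theorem abs_det_halfContract {v : E} (hv : ‖v‖ = 1) :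
    |LinearMap.det (halfContract v).toLinearMap| = 1 / 2 := by
  have h := normDet_halfContract_comp_sq hv (LinearIsometry.id (R := ℝ) (E := E))
    (stdOrthonormalBasis ℝ E)
  simp only [LinearIsometry.id_apply, (stdOrthonormalBasis ℝ E).sum_sq_inner_left, hv] at h
  have h2 : ((halfContract v).toLinearMap ∘ₗ (LinearIsometry.id (R := ℝ) (E := E)).toLinearMap)
      = (halfContract v).toLinearMap := rfl
  rw [h2, LinearMap.normDet_eq_norm_det, Real.norm_eq_abs] at h
  nlinarith [abs_nonneg (LinearMap.det (halfContract v).toLinearMap)]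

end

/-! ### Balanced position by maximizing a determinant ratio -/

section

variable {E : Type*} [NormedAddCommGroup E] [InnerProductSpace ℝ E] [FiniteDimensional ℝ E]

theorem continuous_normDet_domRestrict (R : Submodule ℝ E) :
    Continuous fun M : E →L[ℝ] E => (M.toLinearMap.domRestrict R).normDet := by
  have h : ∀ M : E →L[ℝ] E, (M.toLinearMap.domRestrict R).normDet
      = √(Matrix.gram ℝ fun i => M (stdOrthonormalBasis ℝ R i : E)).det := by
    intro M
    have := LinearMap.normDet_sq_eq_det_gram (M.toLinearMap.domRestrict R) (stdOrthonormalBasis ℝ R)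
    simp only [RCLike.ofReal_real_eq_id, id] at this
    rw [← Real.sqrt_sq (LinearMap.normDet_nonneg _), this]
    rfl
  simp_rw [h]
  refine Real.continuous_sqrt.comp (Continuous.matrix_det (continuous_matrix fun i j => ?_))
  simp only [Matrix.gram_apply]
  fun_prop

theorem normDet_domRestrict_pos {M : E →ₗ[ℝ] E} (hM : LinearMap.det M ≠ 0) (R : Submodule ℝ E) :
    0 < (M.domRestrict R).normDet := by
  have hinj : Function.Injective M := (LinearMap.equivOfDetNeZero M hM).injective
  refine lt_of_le_of_ne (LinearMap.normDet_nonneg _) (Ne.symm ?_)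
  exact ((M.domRestrict R).normDet_ne_zero_tfae.out 4 0).mp fun x y h => Subtype.ext (hinj h)

theorem normDet_comp_domRestrict (g f : E →ₗ[ℝ] E) (R : Submodule ℝ E) :
    ((g ∘ₗ f).domRestrict R).normDet
      = (g.domRestrict (R.map f)).normDet * (f.domRestrict R).normDet := by
  have key : ∀ S : Submodule ℝ E, (f.domRestrict R).range = S →
      ((g ∘ₗ f).domRestrict R).normDet = (g.domRestrict S).normDet * (f.domRestrict R).normDet := by
    rintro _ rfl
    exact LinearMap.normDet_comp (f.domRestrict R) g
  exact key _ (LinearMap.range_domRestrict _ _)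

/-- A family of decompositions of `E` can be moved by a linear automorphism into a position where
the orthogonal projections onto all the summands add up to at most twice (the number of
decompositions plus one). -/
theorem exists_equiv_sum_norm_starProjection_sq_le {τ κ : Type*} [Fintype τ] [Fintype κ]
    [DecidableEq κ] (U : τ → κ → Submodule ℝ E) (hU : ∀ t, DirectSum.IsInternal (U t)) :
    ∃ M : E ≃ₗ[ℝ] E, ∀ v, ∑ t, ∑ i, ‖((U t i).map M.toLinearMap).starProjection v‖ ^ 2
      ≤ 2 * (Fintype.card τ + 1) * ‖v‖ ^ 2 := by
  classical
  choose C hC0 hC using fun t => exists_abs_det_le_mul_prod_normDet (hU t)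
  let N := Fintype.card τ
  let D : (E →L[ℝ] E) → ℝ := fun M => ∏ t, ∏ i, (M.toLinearMap.domRestrict (U t i)).normDet
  -- Fischer's inequality absorbs `N` of the determinant factors into `D`; the extra one makes the
  -- ratio small near singular maps, so that a maximum is attained.
  let F : (E →L[ℝ] E) → ℝ := fun M => |M.det| ^ (N + 1) / D M
  have hDpos : ∀ M : E →L[ℝ] E, M.det ≠ 0 → 0 < D M := fun M hM =>
    Finset.prod_pos fun t _ => Finset.prod_pos fun i _ => normDet_domRestrict_pos hM _
  have hDcont : Continuous D := continuous_finsetProd _ fun t _ =>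
    continuous_finsetProd _ fun i _ => continuous_normDet_domRestrict _
  have hF : ∀ M : E →L[ℝ] E, M.det ≠ 0 → F M ≤ (∏ t, C t) * |M.det| := by
    intro M hM
    have hinj : Function.Injective M := (LinearMap.equivOfDetNeZero M.toLinearMap hM).injective
    rw [div_le_iff₀ (hDpos M hM), pow_succ]
    have : |M.det| ^ N ≤ (∏ t, C t) * D M := by
      calc |M.det| ^ N = ∏ _t : τ, |M.det| := by simp [N]
        _ ≤ ∏ t, (C t * ∏ i, (M.toLinearMap.domRestrict (U t i)).normDet) :=
          Finset.prod_le_prod (fun _ _ => abs_nonneg _) fun t _ => hC t M.toLinearMap hinj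
        _ = (∏ t, C t) * D M := Finset.prod_mul_distrib
    nlinarith [abs_nonneg M.det]
  have hCpos : 0 < ∏ t, C t := Finset.prod_pos fun t _ => hC0 t
  have hdet1 : (ContinuousLinearMap.id ℝ E).det = 1 := by
    simp [ContinuousLinearMap.det]
  have hF1 : 0 < F (ContinuousLinearMap.id ℝ E) :=
    div_pos (by simp [hdet1]) (hDpos _ (by simp [hdet1]))
  -- Below this threshold for `|det|`, the bound `hF` keeps the ratio under its value at the
  -- identity.
  let c := F (ContinuousLinearMap.id ℝ E) / ∏ t, C t
  have hc : 0 < c := div_pos hF1 hCpos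
  let K : Set (E →L[ℝ] E) := {M | ‖M‖ ≤ 1 ∧ c ≤ |M.det|}
  have hKdet : ∀ M ∈ K, M.det ≠ 0 := fun M hM => abs_pos.1 (hc.trans_le hM.2)
  have : ProperSpace (E →L[ℝ] E) := FiniteDimensional.proper ℝ _
  have hdetc : Continuous fun M : E →L[ℝ] E => |M.det| :=
    ContinuousLinearMap.continuous_det.abs
  have hKc : IsCompact K := by
    refine (isCompact_closedBall (0 : E →L[ℝ] E) 1).of_isClosed_subset ?_ fun M hM => by
      simpa using hM.1
    exact (isClosed_le continuous_norm continuous_const).inter (isClosed_le continuous_const hdetc)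
  have h1K : ContinuousLinearMap.id ℝ E ∈ K := by
    refine ⟨ContinuousLinearMap.norm_id_le, ?_⟩
    rw [div_le_iff₀ hCpos, mul_comm]
    exact hF _ (by simp [hdet1])
  obtain ⟨M, hMK, hMmax⟩ := hKc.exists_isMaxOn ⟨_, h1K⟩ (f := F)
    (ContinuousOn.div (hdetc.pow _).continuousOn hDcont.continuousOn
      fun M hM => (hDpos M (hKdet M hM)).ne')
  have hMdet := hKdet M hMK
  have hmax : ∀ M' : E →L[ℝ] E, ‖M'‖ ≤ 1 → M'.det ≠ 0 → F M' ≤ F M := by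
    intro M' h1 h2
    by_cases h3 : c ≤ |M'.det|
    · exact hMmax ⟨h1, h3⟩
    · have h4 : (∏ t, C t) * |M'.det| < F (ContinuousLinearMap.id ℝ E) := by
        rw [not_le, lt_div_iff₀ hCpos] at h3
        linarith
      exact ((hF M' h2).trans h4.le).trans (hMmax h1K)
  let q : E → τ → κ → ℝ := fun v t i =>
    ‖((U t i).map M.toLinearMap).starProjection v‖ ^ 2
  -- Compare the maximizer with its composite with `halfContract v`: the determinant halves while
  -- each volume factor shrinks according to the projection of `v`. Maximality therefore limits the
  -- total projection.
  have hunit : ∀ v : E, ‖v‖ = 1 → ∑ t, ∑ i, q v t i ≤ 2 * (N + 1) := by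
    intro v hv
    let M' : E →L[ℝ] E := (halfContract v).comp M
    let r : τ → κ → ℝ := fun t i =>
      ((halfContract v).toLinearMap.domRestrict ((U t i).map M.toLinearMap)).normDet
    have hM'det : |M'.det| = 1 / 2 * |M.det| := by
      rw [← abs_det_halfContract hv, ← abs_mul]
      congr 1
      exact LinearMap.det_comp _ _
    have hM'D : D M' = (∏ t, ∏ i, r t i) * D M := by
      simp only [D, ← Finset.prod_mul_distrib]
      refine Finset.prod_congr rfl fun t _ => Finset.prod_congr rfl fun i _ => ?_
      exact normDet_comp_domRestrict _ _ _
    have hd' : M'.det ≠ 0 := by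
      rw [← abs_pos, hM'det]
      have := abs_pos.2 hMdet
      positivity
    have hn' : ‖M'‖ ≤ 1 := (ContinuousLinearMap.opNorm_comp_le _ _).trans
      (mul_le_one₀ (norm_halfContract_le hv) (norm_nonneg _) hMK.1)
    have hle := hmax M' hn' hd'
    have hDM := hDpos M hMdet
    have hDM' := hDpos M' hd'
    have hdp : 0 < |M.det| ^ (N + 1) := pow_pos (abs_pos.2 hMdet) _
    have hR : (1 / 2 : ℝ) ^ (N + 1) ≤ ∏ t, ∏ i, r t i := by
      simp only [F] at hle
      rw [div_le_div_iff₀ hDM' hDM, hM'det, hM'D, mul_pow] at hle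
      refine le_of_mul_le_mul_right ?_ (mul_pos hdp hDM)
      linarith
    have hR2 : (1 / 4 : ℝ) ^ (N + 1) ≤ ∏ t, ∏ i, (1 - 3 / 4 * q v t i) := by
      have h := pow_le_pow_left₀ (by positivity) hR 2
      have e1 : ((1 / 2 : ℝ) ^ (N + 1)) ^ 2 = (1 / 4) ^ (N + 1) := by
        rw [← pow_mul, mul_comm, pow_mul]; norm_num
      rw [e1] at h
      simpa only [← Finset.prod_pow, r, normDet_halfContract_domRestrict_sq hv] using h
    have hR3 : ∏ t, ∏ i, (1 - 3 / 4 * q v t i) ≤ Real.exp (-(3 / 4) * ∑ t, ∑ i, q v t i) := by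
      rw [Finset.mul_sum, Real.exp_sum]
      simp_rw [Finset.mul_sum, Real.exp_sum]
      have h0 : ∀ t i, 0 ≤ 1 - 3 / 4 * q v t i := fun t i => by
        have := normDet_halfContract_domRestrict_sq hv ((U t i).map M.toLinearMap)
        have h2 := sq_nonneg (r t i)
        simp only [r, this] at h2
        exact h2
      refine Finset.prod_le_prod (fun t _ => Finset.prod_nonneg fun i _ => h0 t i) fun t _ =>
        Finset.prod_le_prod (fun i _ => h0 t i) fun i _ => ?_
      have := Real.add_one_le_exp (-(3 / 4) * q v t i)
      linarith
    -- From `exp (3 / 2) ≥ 4`; dividing `3 / 2` by the `3 / 4` in the exponent of `hR3` gives the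
    -- constant `2`.
    have hexp : Real.exp (-(3 / 2) * (N + 1)) ≤ (1 / 4 : ℝ) ^ (N + 1) := by
      have h1 : Real.exp (-(3 / 2)) ≤ 1 / 4 := by
        rw [Real.exp_neg, inv_le_comm₀ (Real.exp_pos _) (by norm_num)]
        have h2 : Real.exp (3 / 2) = Real.exp (1 / 2) * Real.exp 1 := by
          rw [← Real.exp_add]; norm_num
        have h3 := Real.add_one_le_exp (1 / 2 : ℝ)
        have h4 := Real.exp_one_gt_d9
        norm_num at h3 h4 ⊢
        nlinarith
      calc Real.exp (-(3 / 2) * (N + 1)) = Real.exp (-(3 / 2)) ^ (N + 1) := by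
            rw [← Real.exp_nat_mul]; push_cast; ring_nf
        _ ≤ _ := pow_le_pow_left₀ (Real.exp_pos _).le h1 _
    have := Real.exp_le_exp.1 (hexp.trans (hR2.trans hR3))
    linarith
  refine ⟨LinearMap.equivOfDetNeZero M.toLinearMap hMdet, fun v => ?_⟩
  have hM0 : (LinearMap.equivOfDetNeZero M.toLinearMap hMdet).toLinearMap = M.toLinearMap := by
    ext; rfl
  rw [hM0]
  by_cases hv : v = 0
  · simp [hv]
  have hv' : ‖v‖ ≠ 0 := norm_ne_zero_iff.2 hv
  have h := hunit (‖v‖⁻¹ • v) (by rw [norm_smul, norm_inv, norm_norm, inv_mul_cancel₀ hv'])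
  simp only [q, map_smul, norm_smul, norm_inv, norm_norm, mul_pow, ← Finset.mul_sum] at h
  rw [inv_pow, inv_mul_le_iff₀ (by positivity)] at h
  linarith

end

/-! ### Near subspaces and packing into independent families -/

section

variable {E : Type*} [NormedAddCommGroup E] [InnerProductSpace ℝ E] [FiniteDimensional ℝ E]

/-- Some unit vector of `A` makes an angle of at most `π / 3` with `B`. -/
def IsNear (A B : Submodule ℝ E) : Prop :=
  ∃ u ∈ A, ‖u‖ = 1 ∧ 1 / 2 ≤ ‖B.starProjection u‖

omit [FiniteDimensional ℝ E] in
theorem exists_mem_norm_eq_one {A : Submodule ℝ E} (hA : A ≠ ⊥) : ∃ u ∈ A, ‖u‖ = 1 := by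
  obtain ⟨x, hx, hx0⟩ := A.exists_mem_ne_zero_of_ne_bot hA
  exact ⟨‖x‖⁻¹ • x, A.smul_mem _ hx, by
    rw [norm_smul, norm_inv, norm_norm, inv_mul_cancel₀ (norm_ne_zero_iff.2 hx0)]⟩

theorem isNear_self {A : Submodule ℝ E} (hA : A ≠ ⊥) : IsNear A A := by
  obtain ⟨u, hu, h1⟩ := exists_mem_norm_eq_one hA
  refine ⟨u, hu, h1, ?_⟩
  rw [Submodule.starProjection_eq_self_iff.2 hu, h1]
  norm_num

theorem IsNear.left_ne_bot {A B : Submodule ℝ E} (h : IsNear A B) : A ≠ ⊥ := by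
  rintro rfl
  obtain ⟨u, hu, h1, -⟩ := h
  simp [(Submodule.mem_bot ℝ).1 hu] at h1

theorem IsNear.right_ne_bot {A B : Submodule ℝ E} (h : IsNear A B) : B ≠ ⊥ := by
  rintro rfl
  obtain ⟨u, hu, -, h1⟩ := h
  rw [Submodule.starProjection_bot] at h1
  norm_num at h1

theorem inner_le_norm_starProjection_mul (B : Submodule ℝ E) (x : E) {y : E} (hy : y ∈ B) :
    |inner ℝ x y| ≤ ‖B.starProjection x‖ * ‖y‖ := by
  have h : inner ℝ x y = inner ℝ (B.starProjection x) y := by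
    rw [Submodule.inner_starProjection_left_eq_right, Submodule.starProjection_eq_self_iff.2 hy]
  rw [h]
  exact abs_real_inner_le_norm _ _

/-- Write a unit vector of `A` as `a + b`. If `A` is near neither `B` nor `C`, then `1 = ⟪a + b, a⟫
+ ⟪a + b, b⟫` forces `‖a‖ + ‖b‖ > 2`. If `B` is not near `C`, then `‖a‖² + ‖b‖² - ‖a‖ ‖b‖ ≤ 1`,
whose left side is at least `(‖a‖ + ‖b‖)² / 4`. -/
theorem exists_isNear_of_le_sup {A B C : Submodule ℝ E} (hA : A ≠ ⊥) (h : A ≤ B ⊔ C) :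
    IsNear A B ∨ IsNear A C ∨ IsNear B C := by
  by_contra hcon
  simp only [IsNear, not_or, not_exists, not_and, not_le] at hcon
  obtain ⟨hAB, hAC, hBC⟩ := hcon
  obtain ⟨v, hv, hv1⟩ := exists_mem_norm_eq_one hA
  obtain ⟨a, ha, b, hb, rfl⟩ := Submodule.mem_sup.1 (h hv)
  have hp := hAB _ hv hv1
  have hs := hAC _ hv hv1
  have h1 : inner ℝ (a + b) a + inner ℝ (a + b) b = 1 := by
    rw [← inner_add_right, real_inner_self_eq_norm_sq, hv1, one_pow]
  have h2 := (le_abs_self _).trans (inner_le_norm_starProjection_mul B (a + b) ha)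
  have h3 := (le_abs_self _).trans (inner_le_norm_starProjection_mul C (a + b) hb)
  have h4 : ‖C.starProjection a‖ ≤ 1 / 2 * ‖a‖ := by
    by_cases ha0 : a = 0
    · simp [ha0]
    have hn : 0 < ‖a‖ := norm_pos_iff.2 ha0
    have := hBC (‖a‖⁻¹ • a) (B.smul_mem _ ha)
      (by rw [norm_smul, norm_inv, norm_norm, inv_mul_cancel₀ hn.ne'])
    rw [map_smul, norm_smul, norm_inv, norm_norm, inv_mul_lt_iff₀ hn] at this
    linarith
  have h5 := (abs_le.1 (inner_le_norm_starProjection_mul C a hb)).1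
  have h6 : ‖a‖ ^ 2 + 2 * inner ℝ a b + ‖b‖ ^ 2 = 1 := by
    rw [← norm_add_sq_real, hv1, one_pow]
  have hx := norm_nonneg a
  have hy := norm_nonneg b
  have h7 : ‖a‖ ^ 2 + ‖b‖ ^ 2 - ‖a‖ * ‖b‖ ≤ 1 := by
    nlinarith [mul_le_mul_of_nonneg_right h4 hy]
  have h8 : 2 < ‖a‖ + ‖b‖ := by
    by_contra h9
    rw [not_lt] at h9
    have hm : max ‖B.starProjection (a + b)‖ ‖C.starProjection (a + b)‖ < 1 / 2 := max_lt hp hs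
    have hm0 : 0 ≤ max ‖B.starProjection (a + b)‖ ‖C.starProjection (a + b)‖ :=
      le_max_of_le_left (norm_nonneg _)
    have e1 := mul_le_mul_of_nonneg_right
      (le_max_left ‖B.starProjection (a + b)‖ ‖C.starProjection (a + b)‖) hx
    have e2 := mul_le_mul_of_nonneg_right
      (le_max_right ‖B.starProjection (a + b)‖ ‖C.starProjection (a + b)‖) hy
    nlinarith
  nlinarith [sq_nonneg (‖a‖ - ‖b‖)]

/-- Cauchy-Schwarz on the coordinates of the witnessing unit vector; this turns nearness into a
quantity that can be summed over `B`. -/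
theorem IsNear.le_sum_norm_sq {A B : Submodule ℝ E} (h : IsNear A B) {ι : Type*} [Fintype ι]
    (e : OrthonormalBasis ι ℝ A) : 1 / 4 ≤ ∑ i, ‖B.starProjection (e i : E)‖ ^ 2 := by
  obtain ⟨u, hu, hu1, hB⟩ := h
  let c : ι → ℝ := fun i => inner ℝ (e i) ⟨u, hu⟩
  have hc : ∑ i, c i ^ 2 = 1 := by
    rw [e.sum_sq_inner_right, Submodule.coe_norm, hu1, one_pow]
  have hsum : u = ∑ i, c i • (e i : E) := by
    have := congrArg Subtype.val (e.sum_repr' ⟨u, hu⟩)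
    simpa [c] using this.symm
  have hle : ‖B.starProjection u‖ ≤ ∑ i, |c i| * ‖B.starProjection (e i : E)‖ := by
    rw [hsum, map_sum]
    refine (norm_sum_le _ _).trans (Finset.sum_le_sum fun i _ => ?_)
    rw [map_smul, norm_smul, Real.norm_eq_abs]
  have hcs := Finset.sum_mul_sq_le_sq_mul_sq Finset.univ (fun i => |c i|)
    fun i => ‖B.starProjection (e i : E)‖
  simp only [sq_abs, hc, one_mul] at hcs
  nlinarith

-- The index `none` carries a complement of the span of the family; indices outside `H` carry `⊥`.
omit [FiniteDimensional ℝ E] in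
theorem Finset.SupIndep.exists_isInternal {ι : Type*} [DecidableEq ι] {H : Finset ι}
    {V : ι → Submodule ℝ E} (hH : H.SupIndep V) :
    ∃ U : Option ι → Submodule ℝ E, DirectSum.IsInternal U ∧ ∀ i ∈ H, U (some i) = V i := by
  obtain ⟨C, hC⟩ := Submodule.exists_isCompl (H.sup V)
  let U : Option ι → Submodule ℝ E := fun o => o.elim C fun i => if i ∈ H then V i else ⊥
  have hU : ∀ i ∈ H, U (some i) = V i := fun i hi => by simp [U, hi]
  have hsup : (H.map Function.Embedding.some).sup U = H.sup V := by
    rw [Finset.sup_map]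
    exact Finset.sup_congr rfl hU
  let K : Finset (Option ι) := insert none (H.map Function.Embedding.some)
  have hind : K.SupIndep U := by
    refine Finset.SupIndep.insert ?_ ?_
    · rw [Finset.supIndep_map]
      exact hH.mono fun i hi => (hU i hi).le
    · rw [hsup]
      exact hC.symm.disjoint
  have hbot : ∀ o ∉ K, U o = ⊥ := by
    rintro (_ | i) ho
    · simp [K] at ho
    · have : i ∉ H := fun h => ho (by simp [K, h])
      simp [U, this]
  refine ⟨U, ?_, hU⟩
  rw [DirectSum.isInternal_submodule_iff_iSupIndep_and_iSup_eq_top]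
  constructor
  · intro o
    by_cases ho : o ∈ K
    · refine (Finset.supIndep_iff_disjoint_erase.1 hind o ho).mono_right ?_
      refine iSup₂_le fun p hp => ?_
      by_cases hpK : p ∈ K
      · exact Finset.le_sup (f := U) (Finset.mem_erase.2 ⟨hp, hpK⟩)
      · simp [hbot p hpK]
    · simp [hbot o ho]
  · rw [eq_top_iff, ← hC.sup_eq_top, ← hsup]
    refine sup_le (Finset.sup_le fun o _ => le_iSup U o) (le_iSup U none)

theorem finrank_finset_sup_le {ι : Type*} [DecidableEq ι] {V : ι → Submodule ℝ E} {k : ℕ}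
    (hV : ∀ i, finrank ℝ (V i) ≤ k) (H : Finset ι) :
    finrank ℝ (H.sup V : Submodule ℝ E) ≤ k * H.card := by
  induction H using Finset.induction_on with
  | empty => simp
  | insert i H hi ih =>
    rw [Finset.sup_insert, Finset.card_insert_of_notMem hi]
    have := Submodule.finrank_add_le_finrank_add_finrank (V i) (H.sup V)
    have := hV i
    rw [Nat.mul_succ]
    omega

/-- If no subspace of dimension at most `b` meets `c` of the spaces nontrivially, then all but
fewer than `c` of the nonzero spaces can be covered by disjoint independent subfamilies with more than
`b / k` members. -/
theorem exists_disjoint_supIndep {ι : Type*} [Fintype ι] [DecidableEq ι] {V : ι → Submodule ℝ E}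
    {k : ℕ} (hV : ∀ i, finrank ℝ (V i) ≤ k) {b c : ℝ} (hb : 0 ≤ b)
    (h : ∀ (W : Submodule ℝ E) (R : Finset ι), (finrank ℝ W : ℝ) ≤ b →
      (∀ i ∈ R, V i ⊓ W ≠ ⊥) → (R.card : ℝ) < c) :
    ∃ F : Finset (Finset ι), (F : Set (Finset ι)).PairwiseDisjoint id ∧
      (∀ H ∈ F, H.SupIndep V ∧ b < k * H.card ∧ ∀ i ∈ H, V i ≠ ⊥) ∧
      (∀ R : Finset ι, (∀ i ∈ R, V i ≠ ⊥ ∧ ∀ H ∈ F, i ∉ H) → (R.card : ℝ) < c) := by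
  classical
  let P : Finset (Finset ι) → Prop := fun F => (F : Set (Finset ι)).PairwiseDisjoint id ∧
      (∀ H ∈ F, H.SupIndep V ∧ b < k * H.card ∧ ∀ i ∈ H, V i ≠ ⊥)
  obtain ⟨F, hF⟩ := Set.Finite.exists_maximal (Set.toFinite {F | P F}) ⟨∅, by simp [P]⟩
  refine ⟨F, hF.prop.1, hF.prop.2, fun R hR => ?_⟩
  obtain ⟨H, hH⟩ := Set.Finite.exists_maximal (Set.toFinite {H : Finset ι | H ⊆ R ∧ H.SupIndep V})
    ⟨∅, by simp⟩
  obtain ⟨hHR, hHi⟩ := hH.prop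
  -- By maximality of `H`, every space left over in `R` meets the span of `H`. That span has
  -- dimension at most `b`, since otherwise `H` could be added to `F`.
  refine h (H.sup V) R ?_ fun i hi hbot => ?_
  · by_contra hlt
    rw [not_le] at hlt
    have hbH : b < k * H.card := hlt.trans_le (by exact_mod_cast finrank_finset_sup_le hV H)
    have hdisj : ∀ H' ∈ F, Disjoint H H' := fun H' hH' =>
      Finset.disjoint_left.2 fun i hi => (hR i (hHR hi)).2 H' hH'
    have hins : P (insert H F) := by
      refine ⟨?_, ?_⟩
      · rw [Finset.coe_insert]
        exact hF.prop.1.insert fun H' hH' _ => hdisj H' hH'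
      · intro H' hH'
        rcases Finset.mem_insert.1 hH' with rfl | hH'
        · exact ⟨hHi, hbH, fun i hi => (hR i (hHR hi)).1⟩
        · exact hF.prop.2 H' hH'
    have hmem : H ∈ F := hF.le_of_ge hins (Finset.subset_insert _ _) (Finset.mem_insert_self _ _)
    have := hdisj H hmem
    rw [disjoint_self, Finset.bot_eq_empty] at this
    simp [this] at hbH
    linarith
  · have hins : insert i H ∈ {H : Finset ι | H ⊆ R ∧ H.SupIndep V} :=
      ⟨Finset.insert_subset hi hHR, hHi.insert (disjoint_iff.2 hbot)⟩
    have hmem : i ∈ H := hH.le_of_ge hins (Finset.subset_insert _ _) (Finset.mem_insert_self _ _)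
    rw [inf_eq_left.2 (Finset.le_sup (f := V) hmem)] at hbot
    exact (hR i hi).1 hbot

end

/-! ### Counting near pairs in balanced position -/

section

variable {E : Type*} [NormedAddCommGroup E] [InnerProductSpace ℝ E] [FiniteDimensional ℝ E]

/-- Disjoint independent families of subspaces can be moved by a linear automorphism so that each
of the spaces is near to few of the others, on average. -/
theorem exists_equiv_card_isNear_le {ι : Type*} [Fintype ι] [DecidableEq ι]
    {V : ι → Submodule ℝ E} {k : ℕ} (hV : ∀ i, finrank ℝ (V i) ≤ k) (F : Finset (Finset ι))
    (hdisj : (F : Set (Finset ι)).PairwiseDisjoint id) (hind : ∀ H ∈ F, H.SupIndep V) :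
    ∃ M : E ≃ₗ[ℝ] E, ∀ B : Finset (ι × ι), B ⊆ F.biUnion id ×ˢ F.biUnion id →
      (∀ p ∈ B, IsNear ((V p.1).map M.toLinearMap) ((V p.2).map M.toLinearMap)) →
      (B.card : ℝ) ≤ 8 * (F.card + 1) * k * (F.biUnion id).card := by
  classical
  choose U hU hUV using fun t : F => (hind t.1 t.2).exists_isInternal
  obtain ⟨M, hM⟩ := exists_equiv_sum_norm_starProjection_sq_le U hU
  refine ⟨M, fun B hB hnear => ?_⟩
  set T := F.biUnion id with hT
  let Q : ι → Submodule ℝ E := fun i => (V i).map M.toLinearMap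
  have hproj : ∀ v, ∑ i ∈ T, ‖(Q i).starProjection v‖ ^ 2 ≤ 2 * (F.card + 1) * ‖v‖ ^ 2 := by
    intro v
    have h := hM v
    rw [Fintype.card_coe] at h
    refine le_trans ?_ h
    rw [hT, Finset.sum_biUnion hdisj, ← Finset.sum_coe_sort F]
    refine Finset.sum_le_sum fun t _ => ?_
    rw [Fintype.sum_option]
    refine le_trans ?_ (le_add_of_nonneg_left (sq_nonneg _))
    calc ∑ i ∈ t.1, ‖(Q i).starProjection v‖ ^ 2
        = ∑ i ∈ t.1, ‖((U t (some i)).map M.toLinearMap).starProjection v‖ ^ 2 :=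
          Finset.sum_congr rfl fun i hi => by rw [hUV t i hi]
      _ ≤ _ := Finset.sum_le_sum_of_subset_of_nonneg (Finset.subset_univ _)
          fun i _ _ => sq_nonneg _
  -- Every near pair contributes at least `1 / 4`, while for fixed `a` each of the at most `k` basis
  -- vectors contributes at most `2 (|F| + 1)` over all `b` in `T`.
  let g : ι → ι → ℝ := fun a b =>
    ∑ l, ‖(Q b).starProjection (stdOrthonormalBasis ℝ (Q a) l : E)‖ ^ 2
  have hg0 : ∀ a b, 0 ≤ g a b := fun a b => Finset.sum_nonneg fun _ _ => sq_nonneg _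
  have hgsum : ∀ a, ∑ b ∈ T, g a b ≤ 2 * (F.card + 1) * k := by
    intro a
    simp only [g]
    rw [Finset.sum_comm]
    have hdim : finrank ℝ (Q a) ≤ k := (Submodule.finrank_map_le _ _).trans (hV a)
    calc _ ≤ ∑ _l : Fin (finrank ℝ (Q a)), 2 * ((F.card : ℝ) + 1) := by
          refine Finset.sum_le_sum fun l _ => ?_
          have h1 : ‖(stdOrthonormalBasis ℝ (Q a) l : E)‖ = 1 :=
            (stdOrthonormalBasis ℝ (Q a)).norm_eq_one l
          simpa [h1] using hproj (stdOrthonormalBasis ℝ (Q a) l : E)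
      _ = 2 * (F.card + 1) * (finrank ℝ (Q a) : ℝ) := by simp; ring
      _ ≤ _ := by gcongr
  calc (B.card : ℝ) = ∑ _p ∈ B, (1 : ℝ) := by simp
    _ ≤ ∑ p ∈ B, 4 * g p.1 p.2 := Finset.sum_le_sum fun p hp => by
        have := (hnear p hp).le_sum_norm_sq (stdOrthonormalBasis ℝ (Q p.1))
        change 1 / 4 ≤ g p.1 p.2 at this
        linarith
    _ ≤ ∑ p ∈ T ×ˢ T, 4 * g p.1 p.2 := Finset.sum_le_sum_of_subset_of_nonneg hB
        fun p _ _ => mul_nonneg (by norm_num) (hg0 _ _)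
    _ = 4 * ∑ a ∈ T, ∑ b ∈ T, g a b := by
        rw [← Finset.mul_sum, Finset.sum_product]
    _ ≤ 4 * ∑ _a ∈ T, 2 * ((F.card : ℝ) + 1) * k := by
        gcongr with a _
        exact hgsum a
    _ = _ := by simp; ring

end

/-! ### Double counting in the system -/

theorem IsSystem.exists_isNear {ℓ n w : ℕ} {α : ℕ} {δ : ℝ}
    {V : Fin n → Submodule ℝ (EuclideanSpace ℝ (Fin ℓ))} {S : Fin w → Finset (Fin n)}
    (hS : IsSystem α δ V S) (M : EuclideanSpace ℝ (Fin ℓ) →ₗ[ℝ] EuclideanSpace ℝ (Fin ℓ))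
    (hM : Function.Injective M) {j : Fin w} {i : Fin n} (hi : i ∈ S j) (hVi : V i ≠ ⊥) :
    ∃ a ∈ S j, ∃ b ∈ S j, a ≠ b ∧ IsNear ((V a).map M) ((V b).map M) := by
  have hbot : (V i).map M ≠ ⊥ := fun h => hVi
    (Submodule.map_injective_of_injective hM (h.trans (Submodule.map_bot M).symm))
  rcases hS.card_eq j with h3 | h2
  · have h2 : ((S j).erase i).card = 2 := by rw [Finset.card_erase_of_mem hi, h3]
    obtain ⟨x, y, hxy, he⟩ := Finset.card_eq_two.1 h2
    have hSj : S j = {i, x, y} := by rw [← Finset.insert_erase hi, he]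
    have hx : x ∈ (S j).erase i := by simp [he]
    have hy : y ∈ (S j).erase i := by simp [he]
    rw [Finset.mem_erase] at hx hy
    have h := (hS.triple j i x y hx.1.symm hy.1.symm hxy hSj).1
    have h' := Submodule.map_mono (f := M) h
    rw [Submodule.map_sup] at h'
    rcases exists_isNear_of_le_sup hbot h' with h | h | h
    · exact ⟨i, hi, x, hx.2, hx.1.symm, h⟩
    · exact ⟨i, hi, y, hy.2, hy.1.symm, h⟩
    · exact ⟨x, hx.2, y, hy.2, hxy, h⟩
  · have h1 : ((S j).erase i).card = 1 := by rw [Finset.card_erase_of_mem hi, h2]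
    obtain ⟨x, he⟩ := Finset.card_eq_one.1 h1
    have hSj : S j = {i, x} := by rw [← Finset.insert_erase hi, he]
    have hx : x ∈ (S j).erase i := by simp [he]
    rw [Finset.mem_erase] at hx
    refine ⟨i, hi, x, hx.2, hx.1.symm, ?_⟩
    rw [← hS.pair j i x hx.1.symm hSj]
    exact isNear_self hbot

/-- The incidences of `i` with sets that meet `X` outside of `i` are few. -/
theorem IsSystem.card_filter_le {ℓ n w : ℕ} {α : ℕ} {δ : ℝ}
    {V : Fin n → Submodule ℝ (EuclideanSpace ℝ (Fin ℓ))} {S : Fin w → Finset (Fin n)}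
    (hS : IsSystem α δ V S) (i : Fin n) (X : Finset (Fin n)) :
    (Finset.univ.filter fun j => i ∈ S j ∧ ∃ x ∈ X, x ≠ i ∧ x ∈ S j).card ≤ α * X.card := by
  classical
  calc _ ≤ ((X.erase i).biUnion fun x =>
          Finset.univ.filter fun j => i ∈ S j ∧ x ∈ S j).card := by
        refine Finset.card_le_card fun j hj => ?_
        obtain ⟨-, hij, x, hx, hxi, hxj⟩ := Finset.mem_filter.1 hj
        simp only [Finset.mem_biUnion, Finset.mem_filter, Finset.mem_erase]
        exact ⟨x, ⟨hxi, hx⟩, Finset.mem_univ _, hij, hxj⟩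
    _ ≤ (X.erase i).card * α := Finset.card_biUnion_le_card_mul _ _ _ fun x hx =>
        hS.pair_count_le i x (Finset.ne_of_mem_erase hx).symm
    _ ≤ α * X.card := by
        rw [mul_comm]
        exact Nat.mul_le_mul_left _ (Finset.card_le_card (Finset.erase_subset _ _))

theorem theorem8 {ℓ n w : ℕ} (k α : ℕ) (δ : ℝ) (hα : 0 < α) (hδ : 0 < δ)
    (V : Fin n → Submodule ℝ (EuclideanSpace ℝ (Fin ℓ)))
    (hV : ∀ i, IsKBounded k (V i))
    (S : Fin w → Finset (Fin n)) (hS : IsSystem α δ V S)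
    (d : ℕ) (hd : d = Module.finrank ℝ (⨆ i, V i : Submodule ℝ (EuclideanSpace ℝ (Fin ℓ))))
    (β : ℝ) (hβ : β ∈ Set.Ioo (0 : ℝ) 1) :
    (d : ℝ) ≤ 400 * (α : ℝ) * (k : ℝ) ^ 3 / (β * δ) ∨
    ∃ (I : Finset (Fin n)) (z : Fin n → EuclideanSpace ℝ (Fin ℓ)),
      δ * (n : ℝ) / (20 * (α : ℝ)) ≤ (I.card : ℝ) ∧
      (∀ i ∈ I, z i ∈ V i ∧ z i ≠ 0) ∧
      (Module.finrank ℝ (Submodule.span ℝ (z '' (I : Set (Fin n)))) : ℝ) ≤ β * (d : ℝ) := by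
  classical
  rw [or_iff_not_imp_right]
  intro hno
  obtain ⟨hβ0, hβ1⟩ := hβ
  have hα' : (0 : ℝ) < α := by exact_mod_cast hα
  rcases Nat.eq_zero_or_pos d with hd0 | hd0
  · rw [hd0, Nat.cast_zero]
    positivity
  have hd' : (0 : ℝ) < d := by exact_mod_cast hd0
  obtain ⟨i₀, hi₀⟩ : ∃ i, V i ≠ ⊥ := by
    by_contra! hall
    have : (⨆ i, V i) = ⊥ := by simp [hall]
    rw [this, finrank_bot] at hd
    omega
  have hn : (0 : ℝ) < n := by exact_mod_cast (Nat.zero_le _).trans_lt i₀.isLt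
  have hk : (1 : ℝ) ≤ k := by
    have h1 : 1 ≤ finrank ℝ (V i₀) := Submodule.one_le_finrank_iff.2 hi₀
    exact_mod_cast h1.trans (hV i₀)
  set c : ℝ := δ * n / (20 * α) with hc
  have hαc : α * c = δ * n / 20 := by rw [hc]; field_simp
  obtain ⟨F, hdisj, hgood, hrest⟩ := exists_disjoint_supIndep (V := V) (k := k) hV
    (b := β * d) (c := c) (by positivity) (by
      intro W R hW hR
      by_contra hlt
      refine hno ?_
      have hex : ∀ i, ∃ z, i ∈ R → z ∈ V i ⊓ W ∧ z ≠ 0 := fun i => by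
        by_cases hi : i ∈ R
        · obtain ⟨z, hz, hz0⟩ := Submodule.exists_mem_ne_zero_of_ne_bot (hR i hi)
          exact ⟨z, fun _ => ⟨hz, hz0⟩⟩
        · exact ⟨0, fun h => absurd h hi⟩
      choose z hz using hex
      refine ⟨R, z, not_lt.1 hlt, fun i hi => ⟨(hz i hi).1.1, (hz i hi).2⟩, le_trans ?_ hW⟩
      exact_mod_cast Submodule.finrank_mono (Submodule.span_le.2 (by
        rintro _ ⟨i, hi, rfl⟩
        exact (hz i hi).1.2)))
  obtain ⟨M, hM⟩ := exists_equiv_card_isNear_le (k := k) hV F hdisj fun H hH => (hgood H hH).1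
  set T := F.biUnion id with hT
  set X : Finset (Fin n) := Finset.univ.filter fun i => V i ≠ ⊥ ∧ i ∉ T with hX
  have hXc : (X.card : ℝ) < c := hrest X fun i hi => by
    obtain ⟨h1, h2⟩ := (Finset.mem_filter.1 hi).2
    exact ⟨h1, fun H hH hiH => h2 (Finset.mem_biUnion.2 ⟨H, hH, hiH⟩)⟩
  have hαX : (α * X.card : ℝ) ≤ δ * n / 20 := by
    rw [← hαc]
    exact mul_le_mul_of_nonneg_left hXc.le hα'.le
  have hnear : ∀ j, ∀ i ∈ S j, V i ≠ ⊥ → ∃ a ∈ S j, ∃ b ∈ S j, a ≠ b ∧ V a ≠ ⊥ ∧ V b ≠ ⊥ ∧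
      IsNear ((V a).map M.toLinearMap) ((V b).map M.toLinearMap) := by
    intro j i hi hVi
    obtain ⟨a, ha, b, hb, hab, hN⟩ := hS.exists_isNear M.toLinearMap M.injective hi hVi
    refine ⟨a, ha, b, hb, hab, ?_, ?_, hN⟩
    · rintro h
      exact hN.left_ne_bot (by rw [h, Submodule.map_bot])
    · rintro h
      exact hN.right_ne_bot (by rw [h, Submodule.map_bot])
  have hbad : ∀ i, ((Finset.univ.filter fun j => i ∈ S j ∧ ∃ x ∈ X, x ≠ i ∧ x ∈ S j).card : ℝ)
      ≤ δ * n / 20 := fun i =>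
    le_trans (by exact_mod_cast hS.card_filter_le i X) hαX
  -- Otherwise every set through `i₀` has a second index in `X`, giving `δ n ≤ δ n / 20`.
  have hTne : T.Nonempty := by
    by_contra hTe
    rw [Finset.not_nonempty_iff_eq_empty] at hTe
    have hsub : (Finset.univ.filter fun j => i₀ ∈ S j) ⊆
        Finset.univ.filter fun j => i₀ ∈ S j ∧ ∃ x ∈ X, x ≠ i₀ ∧ x ∈ S j := by
      intro j hj
      have hj' := (Finset.mem_filter.1 hj).2
      obtain ⟨a, ha, b, hb, hab, hVa, hVb, -⟩ := hnear j i₀ hj' hi₀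
      refine Finset.mem_filter.2 ⟨Finset.mem_univ _, hj', ?_⟩
      by_cases hai : a = i₀
      · exact ⟨b, by simp [hX, hVb, hTe], fun h => hab (hai.trans h.symm), hb⟩
      · exact ⟨a, by simp [hX, hVa, hTe], hai, ha⟩
    have h1 : δ * n ≤ δ * n / 20 := (hS.le_count i₀).trans
      (le_trans (by exact_mod_cast Finset.card_le_card hsub) (hbad i₀))
    have := mul_pos hδ hn
    linarith
  have hTpos : (0 : ℝ) < T.card := by exact_mod_cast hTne.card_pos
  -- Zero spaces may occur in these sets: both members of a near pair are nonzero, so the pair still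
  -- lies in `T`.
  let G : Finset (Fin w) := Finset.univ.filter fun j =>
    (∃ i ∈ S j, V i ≠ ⊥) ∧ ∀ i ∈ S j, V i ≠ ⊥ → i ∈ T
  let B : Finset (Fin n × Fin n) := (T ×ˢ T).filter fun p => p.1 ≠ p.2 ∧
    IsNear ((V p.1).map M.toLinearMap) ((V p.2).map M.toLinearMap)
  have hBcard := hM B (Finset.filter_subset _ _) fun p hp => (Finset.mem_filter.1 hp).2.2
  have hGB : G.card ≤ B.card * α := by
    have hsub : G ⊆ B.biUnion fun p => Finset.univ.filter fun j => p.1 ∈ S j ∧ p.2 ∈ S j := by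
      intro j hj
      obtain ⟨-, ⟨i, hi, hVi⟩, hall⟩ := Finset.mem_filter.1 hj
      obtain ⟨a, ha, b, hb, hab, hVa, hVb, hN⟩ := hnear j i hi hVi
      exact Finset.mem_biUnion.2 ⟨(a, b), Finset.mem_filter.2
        ⟨Finset.mem_product.2 ⟨hall a ha hVa, hall b hb hVb⟩, hab, hN⟩,
        Finset.mem_filter.2 ⟨Finset.mem_univ _, ha, hb⟩⟩
    refine (Finset.card_le_card hsub).trans (Finset.card_biUnion_le_card_mul _ _ _ fun p hp => ?_)
    exact hS.pair_count_le _ _ (Finset.mem_filter.1 hp).2.1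
  have hTi : ∀ i ∈ T, 19 / 20 * (δ * n) ≤ ((G.filter fun j => i ∈ S j).card : ℝ) := by
    intro i hi
    obtain ⟨H, hH, hiH⟩ := Finset.mem_biUnion.1 hi
    have hVi := (hgood H hH).2.2 i hiH
    have hsub : (Finset.univ.filter fun j => i ∈ S j) ⊆ (G.filter fun j => i ∈ S j) ∪
        Finset.univ.filter fun j => i ∈ S j ∧ ∃ x ∈ X, x ≠ i ∧ x ∈ S j := by
      intro j hj
      have hj' := (Finset.mem_filter.1 hj).2
      rw [Finset.mem_union]
      by_cases hx : ∃ x ∈ X, x ≠ i ∧ x ∈ S j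
      · exact Or.inr (Finset.mem_filter.2 ⟨Finset.mem_univ _, hj', hx⟩)
      · refine Or.inl (Finset.mem_filter.2 ⟨Finset.mem_filter.2 ⟨Finset.mem_univ _,
          ⟨i, hj', hVi⟩, fun x hxj hVx => ?_⟩, hj'⟩)
        by_contra hxT
        exact hx ⟨x, by simp [hX, hVx, hxT], fun h => hxT (h ▸ hi), hxj⟩
    have h1 := hS.le_count i
    have h2 := (Finset.card_le_card hsub).trans (Finset.card_union_le _ _)
    have h3 : ((Finset.univ.filter fun j => i ∈ S j).card : ℝ) ≤
        ((G.filter fun j => i ∈ S j).card : ℝ) +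
        ((Finset.univ.filter fun j => i ∈ S j ∧ ∃ x ∈ X, x ≠ i ∧ x ∈ S j).card : ℝ) := by
      exact_mod_cast h2
    linarith [hbad i]
  have hcount : ∑ i ∈ T, (G.filter fun j => i ∈ S j).card ≤ G.card * 3 := by
    have h := Finset.sum_card_bipartiteAbove_eq_sum_card_bipartiteBelow (s := T) (t := G)
      fun i j => i ∈ S j
    simp only [Finset.bipartiteAbove, Finset.bipartiteBelow] at h
    rw [h]
    refine Finset.sum_le_card_nsmul _ _ _ fun j _ => ?_
    have h1 : (T.filter fun i => i ∈ S j).card ≤ (S j).card :=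
      Finset.card_le_card fun i hi => (Finset.mem_filter.1 hi).2
    rcases hS.card_eq j with h2 | h2 <;> omega
  have hlow : T.card * (19 / 20 * (δ * n)) ≤ G.card * 3 := by
    calc _ = ∑ _i ∈ T, 19 / 20 * (δ * n) := by simp
      _ ≤ ∑ i ∈ T, ((G.filter fun j => i ∈ S j).card : ℝ) := Finset.sum_le_sum hTi
      _ ≤ _ := by exact_mod_cast hcount
  have hN1 : (1 : ℝ) ≤ F.card := by
    obtain ⟨i, hi⟩ := hTne
    obtain ⟨H, hH, -⟩ := Finset.mem_biUnion.1 hi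
    exact_mod_cast Finset.card_pos.2 ⟨H, hH⟩
  have hNn : F.card * (β * d) ≤ k * n := by
    have hTn : T.card ≤ n := by simpa using Finset.card_le_univ T
    calc (F.card : ℝ) * (β * d) = ∑ _H ∈ F, β * d := by simp
      _ ≤ ∑ H ∈ F, (k : ℝ) * H.card := Finset.sum_le_sum fun H hH => (hgood H hH).2.1.le
      _ = k * T.card := by
          rw [← Finset.mul_sum, hT, Finset.card_biUnion hdisj]
          simp
      _ ≤ k * n := by gcongr
  have hGB' : (G.card : ℝ) ≤ B.card * α := by exact_mod_cast hGB
  have hkey : 19 / 20 * (δ * n) ≤ 48 * α * k * F.card := by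
    refine le_of_mul_le_mul_left ?_ hTpos
    calc T.card * (19 / 20 * (δ * n)) ≤ B.card * α * 3 := by linarith
      _ ≤ 8 * (F.card + 1) * k * T.card * α * 3 := by gcongr
      -- Uses `hN1`, that there is at least one family.
      _ ≤ 8 * (F.card + F.card) * k * T.card * α * 3 := by gcongr
      _ = _ := by ring
  have hfin : 19 / 20 * (δ * (β * d)) ≤ 48 * α * k * k := by
    refine le_of_mul_le_mul_right ?_ hn
    calc 19 / 20 * (δ * (β * d)) * n = 19 / 20 * (δ * n) * (β * d) := by ring
      _ ≤ 48 * α * k * F.card * (β * d) := by gcongr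
      _ = 48 * α * k * (F.card * (β * d)) := by ring
      _ ≤ 48 * α * k * (k * n) := by gcongr
      _ = _ := by ring
  rw [le_div_iff₀ (by positivity)]
  -- The argument yields `k ^ 2`; the weaker `k ^ 3` follows from `1 ≤ k`.
  have hk3 : (α : ℝ) * k * k ≤ α * k ^ 3 := by
    have : (0 : ℝ) ≤ α * k * k := by positivity
    nlinarith
  have : (0 : ℝ) ≤ α * k * k := by positivity
  linarith
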